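/- Let $p\ge 3$ be a prime, let $F$ be a field of characteristic $p$, and let $n\ge 3$. Let $A(n)=F[x_1,\dots,x_n]/(x_1^p,\dots,x_n^p)$ and let $W(n)=\mathrm{Der}_F A(n)$ be the Lie algebra of its derivations, which is a free $A(n)$-module with basis $D_1,\dots,D_n$, where $D_i=\partial/\partial x_i$. Let $\mathrm{div}\colon W(n)\to A(n)$ be given by $\mathrm{div}(\sum_i f_iD_i)=\sum_i D_i(f_i)$, let $S'(n)=\{E\in W(n) : \mathrm{div}(E)=0\}$, and let $S(n)=[S'(n),S'(n)]$ be its derived algebra (the Special algebra). Put $\tau=(p-1,\dots,p-1)$, and let $A(n)_{<\tau}\subset A(n)$ be the $F$-span of the monomials $x^a=x_1^{a_1}\cdots x_n^{a_n}$ with $0\le a_i\le p-1$ for all $i$ and $a\ne\tau$. It is an $S(n)$-submodule of $A(n)$ for the natural action of derivations. For $1\le i\le n$ let $\chi_i\colon S(n)\to A(n)_{<\tau}$ be the restriction to $S(n)$ of the $F$-linear map $W(n)\to A(n)$ determined by $$\chi_i(x^aD_k)=\begin{cases} x^a\, x_i^{p-1} & \text{if } k=i,\\ 0 & \text{otherwise,}\end{cases}$$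 and let $\mathrm{ad}(x^\tau)\colon S(n)\to A(n)_{<\tau}$ be the map $E\mapsto E(x^\tau)$. (Both do take values in $A(n)_{<\tau}$.) Then $\chi_1,\dots,\chi_n$ and $\mathrm{ad}(x^\tau)$ are $1$-cocycles of $S(n)$ with values in $A(n)_{<\tau}$, and their classes form a basis over $F$ of the Lie algebra cohomology group $H^1(S(n),A(n)_{<\tau})$. In particular this group has dimension $n+1$. -/

import Mathlib

open MvPolynomial

noncomputable section

/-! ### First cohomology of a Lie algebra with coefficients in a module -/

namespace LieH1

variable (R L M : Type*) [CommRing R] [LieRing L] [LieAlgebra R L]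
  [AddCommGroup M] [Module R M] [LieRingModule L M] [LieModule R L M]

/-- The Chevalley-Eilenberg differential `C⁰(L, M) = M → C¹(L, M)`, `(d m)(x) = x · m`. -/
def d₀₁ : M →ₗ[R] LieModule.Cohomology.oneCochain R L M where
  toFun m :=
    { toFun := fun x => ⁅x, m⁆
      map_add' := fun x y => add_lie x y m
      map_smul' := fun r x => smul_lie r x m }
  map_add' m m' := by ext x; simp
  map_smul' r m := by ext x; simp

/-- The 1-cocycles `Z¹(L, M)`: the kernel of `(d f)(x, y) = x · f y - y · f x - f [x, y]`. -/
def Z : Submodule R (LieModule.Cohomology.oneCochain R L M) :=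
  LinearMap.ker (LieModule.Cohomology.d₁₂ R L M)

/-- The 1-coboundaries `B¹(L, M)`. -/
def B : Submodule R (LieModule.Cohomology.oneCochain R L M) :=
  LinearMap.range (d₀₁ R L M)

theorem B_le_Z : B R L M ≤ Z R L M := by
  rintro _ ⟨m, rfl⟩
  rw [Z, LinearMap.mem_ker]
  ext x y
  simp [d₀₁]

/-- `H¹(L, M) = Z¹(L, M) / B¹(L, M)`. -/
abbrev H : Type _ := Z R L M ⧸ (B R L M).submoduleOf (Z R L M)

variable {R L M}

/-- The cohomology class of a 1-cocycle. -/
def mkClass (f : LieModule.Cohomology.oneCochain R L M) (hf : f ∈ Z R L M) : H R L M :=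
  Submodule.Quotient.mk ⟨f, hf⟩

end LieH1

namespace Special

variable (F : Type*) [Field F] (p n : ℕ)

/-- The truncated polynomial algebra `A(n) = F[x₁, …, xₙ] / (x₁ᵖ, …, xₙᵖ)`. -/
abbrev A : Type _ :=
  MvPolynomial (Fin n) F ⧸ Ideal.span (Set.range fun i : Fin n => (X i : MvPolynomial (Fin n) F) ^ p)

/-- The Jacobson-Witt algebra `W(n) = Der_F A(n)`. -/
abbrev W : Type _ := Derivation F (A F p n) (A F p n)

/-- The quotient map from polynomials to `A(n)`. -/
def proj : MvPolynomial (Fin n) F →ₐ[F] A F p n := Ideal.Quotient.mkₐ F _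

theorem proj_surjective : Function.Surjective (proj F p n) := Ideal.Quotient.mkₐ_surjective F _

variable {n}

/-- The generator `xᵢ` of `A(n)`. -/
def x (i : Fin n) : A F p n := proj F p n (X i)

/-- The monomial `x^a`. -/
def xPow (a : Fin n → ℕ) : A F p n := ∏ i, x F p i ^ a i

variable (n)

/-- The exponent `τ = (p - 1, …, p - 1)`. -/
def tau : Fin n → ℕ := fun _ => p - 1

/-- The subspace `A(n)_{<τ}` spanned by the basis monomials `x^a`, `0 ≤ a ≤ τ`, other than `x^τ`. -/
def belowTauSubmodule : Submodule F (A F p n) :=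
  Submodule.span F {f | ∃ a : Fin n → ℕ, a ≤ tau p n ∧ a ≠ tau p n ∧ f = xPow F p a}

variable {F p n}

theorem proj_monomial (a : Fin n →₀ ℕ) (c : F) :
    proj F p n (monomial a c) = c • xPow F p a := by
  rw [monomial_eq, ← smul_eq_C_mul, map_smul, Finsupp.prod_fintype _ _ (by simp), map_prod]
  simp [xPow, x]

theorem x_pow_p (i : Fin n) : x F p i ^ p = 0 := by
  rw [x, ← map_pow]
  exact Ideal.Quotient.eq_zero_iff_mem.2 (Ideal.subset_span ⟨i, rfl⟩)

theorem xPow_eq_zero (a : Fin n → ℕ) (i : Fin n) (h : p ≤ a i) : xPow F p a = 0 :=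
  Finset.prod_eq_zero (Finset.mem_univ i) (pow_eq_zero_of_le h (x_pow_p i))

theorem W_ext {E G : W F p n} (h : ∀ i, E (x F p i) = G (x F p i)) : E = G := by
  ext f
  obtain ⟨f, rfl⟩ := proj_surjective F p n f
  induction f using MvPolynomial.induction_on with
  | C a =>
    rw [← algebraMap_eq, AlgHom.commutes, E.map_algebraMap, G.map_algebraMap]
  | add f g hf hg => rw [map_add, map_add, map_add, hf, hg]
  | mul_X f i hf =>
    rw [map_mul, Derivation.leibniz, Derivation.leibniz, hf]
    exact congrArg₂ _ (congrArg _ (h i)) rfl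

variable [CharP F p]

theorem proj_pderiv_eq_zero (i : Fin n) (f : MvPolynomial (Fin n) F) (hf : proj F p n f = 0) :
    proj F p n (pderiv i f) = 0 := by
  have hf' : f ∈ Ideal.span (Set.range fun i : Fin n => (X i : MvPolynomial (Fin n) F) ^ p) :=
    Ideal.Quotient.eq_zero_iff_mem.1 hf
  clear hf
  induction hf' using Submodule.span_induction with
  | mem g hg =>
    obtain ⟨j, rfl⟩ := hg
    simp [Derivation.leibniz_pow]
  | zero => simp
  | add f g _ _ hf hg => rw [map_add, map_add, hf, hg, add_zero]
  | smul a g hg h =>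
    have : proj F p n g = 0 := Ideal.Quotient.eq_zero_iff_mem.2 hg
    simp [smul_eq_mul, Derivation.leibniz, h, this]

variable (F p)

/-- The partial derivative `Dᵢ = ∂/∂xᵢ` of `A(n)`. -/
def D (i : Fin n) : W F p n :=
  Derivation.liftOfSurjective (proj_surjective F p n) (proj_pderiv_eq_zero (p := p) i)

variable {F p}

theorem D_proj (i : Fin n) (f : MvPolynomial (Fin n) F) :
    D F p i (proj F p n f) = proj F p n (pderiv i f) :=
  Derivation.liftOfSurjective_apply (proj_surjective F p n) (proj_pderiv_eq_zero (p := p) i) f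

theorem D_x (i j : Fin n) : D F p i (x F p j) = if i = j then 1 else 0 := by
  rw [x, D_proj, pderiv_X]
  by_cases h : i = j <;> simp [h, eq_comm]

/-- Every derivation of `A(n)` is `∑ fᵢ Dᵢ` with `fᵢ = E(xᵢ)`. -/
theorem W_eq_sum (E : W F p n) : E = ∑ i, E (x F p i) • D F p i := by
  apply W_ext
  intro j
  have : (∑ i, E (x F p i) • D F p i) (x F p j) = ∑ i, E (x F p i) • D F p i (x F p j) := by
    rw [← Derivation.coeFnAddMonoidHom_apply, map_sum, Finset.sum_apply]
    rfl
  rw [this]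
  simp [D_x]

theorem W_apply (E : W F p n) (f : A F p n) : E f = ∑ i, E (x F p i) * D F p i f := by
  conv_lhs => rw [W_eq_sum E]
  rw [← Derivation.coeFnAddMonoidHom_apply, map_sum, Finset.sum_apply]
  rfl

theorem D_comm (i j : Fin n) (f : A F p n) : D F p i (D F p j f) = D F p j (D F p i f) := by
  have : ⁅D F p i, D F p j⁆ = (0 : W F p n) := by
    apply W_ext
    intro k
    rw [Derivation.commutator_apply, D_x, D_x]
    split_ifs <;> simp
  have h := congrArg (fun E : W F p n => E f) this
  simpa [Derivation.commutator_apply, sub_eq_zero] using h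

variable (F p n)

/-- The divergence `∑ fᵢ Dᵢ ↦ ∑ Dᵢ(fᵢ)`. -/
def div : W F p n →ₗ[F] A F p n where
  toFun E := ∑ i, D F p i (E (x F p i))
  map_add' E G := by simp [Finset.sum_add_distrib]
  map_smul' c E := by simp [Finset.smul_sum]

variable {F p n}

theorem div_apply (E : W F p n) : div F p n E = ∑ i, D F p i (E (x F p i)) := rfl

theorem div_lie (E G : W F p n) :
    div F p n ⁅E, G⁆ = E (div F p n G) - G (div F p n E) := by
  have key : ∀ E G : W F p n, ∑ i, D F p i (E (G (x F p i))) =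
      (∑ i, ∑ j, D F p i (E (x F p j)) * D F p j (G (x F p i))) + E (div F p n G) := by
    intro E G
    rw [div_apply, map_sum, ← Finset.sum_add_distrib]
    refine Finset.sum_congr rfl fun i _ => ?_
    rw [W_apply E (G (x F p i)), W_apply E (D F p i _), map_sum, ← Finset.sum_add_distrib]
    refine Finset.sum_congr rfl fun j _ => ?_
    rw [Derivation.leibniz, smul_eq_mul, smul_eq_mul, D_comm i j]
    ring
  have hs : (∑ i, ∑ j, D F p i (E (x F p j)) * D F p j (G (x F p i))) =
      ∑ i, ∑ j, D F p i (G (x F p j)) * D F p j (E (x F p i)) := by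
    rw [Finset.sum_comm]
    exact Finset.sum_congr rfl fun i _ => Finset.sum_congr rfl fun j _ => mul_comm _ _
  rw [div_apply]
  simp only [Derivation.commutator_apply, map_sub, Finset.sum_sub_distrib]
  rw [key E G, key G E, hs]
  ring

variable (F p n)

/-- `S'(n) = {E ∈ W(n) | div E = 0}`. -/
def S' : LieSubalgebra F (W F p n) where
  __ := LinearMap.ker (div F p n)
  lie_mem' {E G} hE hG := by
    change div F p n E = 0 at hE
    change div F p n G = 0 at hG
    change div F p n ⁅E, G⁆ = 0
    rw [div_lie, hE, hG, map_zero, map_zero, sub_zero]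

/-- The Special algebra `S(n) = [S'(n), S'(n)]`, as a Lie subalgebra of `W(n)`. -/
def S : LieSubalgebra F (W F p n) :=
  ((LieAlgebra.derivedSeries F (S' F p n) 1).toLieSubalgebra).map (S' F p n).incl

variable {F p n}

theorem mem_S_iff (E : W F p n) :
    E ∈ S F p n ↔
      E ∈ Submodule.span F {G : W F p n | ∃ a ∈ S' F p n, ∃ b ∈ S' F p n, ⁅a, b⁆ = G} := by
  have h1 : E ∈ S F p n ↔ E ∈ Submodule.map ((S' F p n).incl : S' F p n →ₗ[F] W F p n)
      ((LieAlgebra.derivedSeries F (S' F p n) 1 : LieIdeal F (S' F p n)) :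
        Submodule F (S' F p n)) := Iff.rfl
  rw [h1, LieAlgebra.coe_derivedSeries_one_eq, Submodule.map_span]
  suffices h : (S' F p n).incl '' {x | ∃ a b : S' F p n, ⁅a, b⁆ = x} =
      {G : W F p n | ∃ a ∈ S' F p n, ∃ b ∈ S' F p n, ⁅a, b⁆ = G} by
    rw [← h]; rfl
  ext G
  constructor
  · rintro ⟨_, ⟨a, b, rfl⟩, rfl⟩
    exact ⟨a, a.2, b, b.2, rfl⟩
  · rintro ⟨a, ha, b, hb, rfl⟩
    exact ⟨_, ⟨⟨a, ha⟩, ⟨b, hb⟩, rfl⟩, rfl⟩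

theorem S_le_S' : S F p n ≤ S' F p n := by
  rintro _ ⟨E, -, rfl⟩
  exact E.2

variable (F p)

/-- The linear map `W(n) → A(n)`, `∑ fₖ Dₖ ↦ fᵢ xᵢ^{p-1}`. -/
def chiW (i : Fin n) : W F p n →ₗ[F] A F p n where
  toFun E := E (x F p i) * x F p i ^ (p - 1)
  map_add' E G := by simp [add_mul]
  map_smul' c E := by simp [smul_mul_assoc]

/-- `χᵢ(x^a Dₖ)` is `x^a xᵢ^{p-1}` if `k = i` and `0` otherwise. -/
theorem chiW_xPow_smul_D (i k : Fin n) (a : Fin n → ℕ) :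
    chiW F p i (xPow F p a • D F p k) =
      if k = i then xPow F p a * x F p i ^ (p - 1) else 0 := by
  by_cases h : k = i <;> simp [chiW, D_x, h]

variable {F p}

variable [Fact p.Prime]

theorem D_mem_belowTau (i : Fin n) (f : A F p n) : D F p i f ∈ belowTauSubmodule F p n := by
  obtain ⟨f, rfl⟩ := proj_surjective F p n f
  rw [D_proj]
  induction f using MvPolynomial.induction_on' with
  | add f g hf hg => rw [map_add, map_add]; exact add_mem hf hg
  | monomial a c =>
    rw [pderiv_monomial, proj_monomial]
    set b := a - Finsupp.single i 1 with hb
    by_cases h : (b : Fin n → ℕ) ≤ tau p n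
    · by_cases h' : (b : Fin n → ℕ) = tau p n
      · have hi := congrFun h' i
        simp [hb, tau] at hi
        have : (a i : F) = 0 := by
          rcases Nat.eq_zero_or_pos (a i) with h0 | h0
          · simp [h0]
          · have hp := (Fact.out : p.Prime).pos
            have : a i = p := by omega
            rw [this, CharP.cast_eq_zero]
        simp [this]
      · exact Submodule.smul_mem _ _ (Submodule.subset_span ⟨b, h, h', rfl⟩)
    · obtain ⟨j, hj⟩ := not_forall.1 h
      rw [xPow_eq_zero _ j (by simp only [tau] at hj; omega), smul_zero]
      exact zero_mem _

theorem S'_apply_mem_belowTau {E : W F p n} (hE : E ∈ S' F p n) (f : A F p n) :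
    E f ∈ belowTauSubmodule F p n := by
  have hE' : ∑ i, D F p i (E (x F p i)) = 0 := hE
  have : E f = ∑ i, D F p i (f * E (x F p i)) := by
    simp only [Derivation.leibniz, smul_eq_mul, Finset.sum_add_distrib, ← Finset.mul_sum, hE']
    rw [W_apply]; simp
  rw [this]
  exact sum_mem fun i _ => D_mem_belowTau i _

variable (F p n)

/-- `A(n)_{<τ}` as an `S(n)`-submodule of `A(n)`, on which derivations act naturally. -/
def belowTau : LieSubmodule F (S F p n) (A F p n) where
  __ := belowTauSubmodule F p n
  lie_mem {E f} _ := S'_apply_mem_belowTau (S_le_S' E.2) f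

/-- The 1-cochain `ad(x^τ) : E ↦ E(x^τ)` of `S(n)` with values in `A(n)_{<τ}`. -/
def adTau : LieModule.Cohomology.oneCochain F (S F p n) (belowTau F p n) where
  toFun E := ⟨E.1 (xPow F p (tau p n)), S'_apply_mem_belowTau (S_le_S' E.2) _⟩
  map_add' _ _ := rfl
  map_smul' _ _ := rfl

variable {n}

theorem chiW_mem_belowTau (i : Fin n) {E : W F p n} (hE : E ∈ S F p n) :
    chiW F p i E ∈ belowTauSubmodule F p n := by
  rw [mem_S_iff] at hE
  induction hE using Submodule.span_induction with
  | mem G hG =>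
    obtain ⟨a, ha, b, hb, rfl⟩ := hG
    have : chiW F p i ⁅a, b⁆ = a (chiW F p i b) - b (chiW F p i a) := by
      simp only [chiW, LinearMap.coe_mk, AddHom.coe_mk, Derivation.commutator_apply,
        Derivation.leibniz, Derivation.leibniz_pow, smul_eq_mul, nsmul_eq_mul]
      ring
    rw [this]
    exact sub_mem (S'_apply_mem_belowTau ha _) (S'_apply_mem_belowTau hb _)
  | zero => rw [map_zero]; exact zero_mem _
  | add _ _ _ _ h h' => rw [map_add]; exact add_mem h h'
  | smul c _ _ h => rw [map_smul]; exact Submodule.smul_mem _ _ h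

/-- The 1-cochain `χᵢ` of `S(n)` with values in `A(n)_{<τ}`: the restriction of
`∑ fₖ Dₖ ↦ fᵢ xᵢ^{p-1}`. -/
def chi (i : Fin n) : LieModule.Cohomology.oneCochain F (S F p n) (belowTau F p n) where
  toFun E := ⟨chiW F p i E.1, chiW_mem_belowTau F p i E.2⟩
  map_add' E G := Subtype.ext (map_add (chiW F p i) E.1 G.1)
  map_smul' c E := Subtype.ext (map_smul (chiW F p i) c E.1)

end Special

end

/-! Everything is decided by the values on the commuting elements `D i`, which lie in S(n). For a
cocycle φ put g_i = φ(D_i). Since [D_i, D_j] = 0, the 1-form ∑ g_i dx_i is closed, and the truncated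
de Rham computation `exists_potential` gives g_i = D_i h + c_i x_i^{p-1}. Here χ_i accounts for
x_i^{p-1} dx_i, ad(x^τ) for the x^τ-term of h, and a coboundary for the rest of h. Conversely, D_k
never produces x_k^{p-1}, and no coboundary from A(n)_{<τ} reproduces D_k(x^τ) for all k, so the
classes are independent.

There remains rigidity: a cocycle vanishing on all D_i is zero (`eq_zero_of_apply_D_eq_zero`). Let N
be its kernel and C the preimage of the constants F·1. Derivations kill constants, so [C, C] ⊆ N;
and if every [D_i, E] lies in N, then all D_i φ(E) vanish and E ∈ C. Hence x_i D_j ∈ C, the torus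
elements x_i D_i - x_j D_j lie in N, and a torus eigenvector in C with nonzero eigenvalue lies in N.
Induction on degree then reaches a spanning set of S(n). -/

noncomputable section

namespace Special

/-! ### Coefficients in the truncated polynomial algebra -/

section Coefficients

variable {F : Type*} [Field F] {p n : ℕ}

/-- The ideal is generated by monomials, so membership is tested monomial by monomial on the
support. -/
theorem proj_eq_zero_iff (f : MvPolynomial (Fin n) F) :
    proj F p n f = 0 ↔ ∀ a : Fin n →₀ ℕ, (∀ i, a i < p) → coeff a f = 0 := by
  have hset : (Set.range fun i : Fin n => (X i : MvPolynomial (Fin n) F) ^ p) =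
      (fun s => monomial s (1 : F)) '' (Set.range fun i : Fin n => Finsupp.single i p) := by
    rw [← Set.range_comp]
    congr 1
    ext1 i
    simp [X_pow_eq_monomial]
  have h : proj F p n f = 0 ↔
      f ∈ Ideal.span (Set.range fun i : Fin n => (X i : MvPolynomial (Fin n) F) ^ p) :=
    Ideal.Quotient.eq_zero_iff_mem
  rw [h, hset, mem_ideal_span_monomial_image]
  constructor
  · intro h a ha
    by_contra hc
    obtain ⟨_, ⟨i, rfl⟩, hi⟩ := h a (mem_support_iff.2 hc)
    have := hi i
    rw [Finsupp.single_eq_same] at this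
    exact absurd (ha i) (by omega)
  · intro h a ha
    by_contra! hc
    refine mem_support_iff.1 ha (h a fun i => ?_)
    by_contra! hi
    exact hc _ ⟨i, rfl⟩ (Finsupp.single_le_iff.2 hi)

variable (F p) in
open Classical in
/-- The coefficient of the basis monomial `x^a` in an element of `A(n)`; zero if `a` is not a
truncated exponent. -/
def co (a : Fin n →₀ ℕ) : A F p n →ₗ[F] F where
  toFun f := if ∀ i, a i < p then coeff a (Function.surjInv (proj_surjective F p n) f) else 0
  map_add' f g := by
    split_ifs with ha
    · rw [← coeff_add, ← sub_eq_zero, ← coeff_sub]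
      refine (proj_eq_zero_iff (p := p) _).1 ?_ a ha
      simp [Function.surjInv_eq]
    · simp
  map_smul' c f := by
    split_ifs with ha
    · rw [RingHom.id_apply, ← coeff_smul, ← sub_eq_zero, ← coeff_sub]
      refine (proj_eq_zero_iff (p := p) _).1 ?_ a ha
      simp [Function.surjInv_eq]
    · simp

theorem co_proj {a : Fin n →₀ ℕ} (ha : ∀ i, a i < p) (f : MvPolynomial (Fin n) F) :
    co F p a (proj F p n f) = coeff a f := by
  have : co F p a (proj F p n f) =
      coeff a (Function.surjInv (proj_surjective F p n) (proj F p n f)) := if_pos ha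
  rw [this, ← sub_eq_zero, ← coeff_sub]
  refine (proj_eq_zero_iff (p := p) _).1 ?_ a ha
  simp [Function.surjInv_eq]

theorem co_eq_zero_of_le {a : Fin n →₀ ℕ} {i : Fin n} (h : p ≤ a i) (f : A F p n) :
    co F p a f = 0 :=
  if_neg fun ha => absurd (ha i) (by omega)

theorem eq_of_co_eq {f g : A F p n}
    (h : ∀ a : Fin n →₀ ℕ, (∀ i, a i < p) → co F p a f = co F p a g) : f = g := by
  obtain ⟨f, rfl⟩ := proj_surjective F p n f
  obtain ⟨g, rfl⟩ := proj_surjective F p n g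
  rw [← sub_eq_zero, ← map_sub, proj_eq_zero_iff]
  intro a ha
  rw [coeff_sub, ← co_proj ha, ← co_proj ha, h a ha, sub_self]

theorem co_xPow {a : Fin n →₀ ℕ} (ha : ∀ i, a i < p) (b : Fin n →₀ ℕ) :
    co F p a (xPow F p b) = if b = a then 1 else 0 := by
  classical
  have : xPow F p b = proj F p n (monomial b 1) := by rw [proj_monomial, one_smul]
  rw [this, co_proj ha, coeff_monomial]

theorem xPow_single (i : Fin n) (k : ℕ) :
    xPow F p (Finsupp.single i k : Fin n →₀ ℕ) = x F p i ^ k := by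
  rw [xPow, Finset.prod_eq_single i]
  · simp
  · intro j _ hj
    rw [Finsupp.single_eq_of_ne hj, pow_zero]
  · simp

theorem exists_co_eq (u : (Fin n →₀ ℕ) → F) :
    ∃ f : A F p n, ∀ a : Fin n →₀ ℕ, (∀ i, a i < p) → co F p a f = u a := by
  classical
  -- The box bounded by p is larger than needed; monomials with an exponent equal to p vanish.
  let t : Fin n →₀ ℕ := Finsupp.equivFunOnFinite.symm fun _ => p
  refine ⟨∑ b ∈ Finset.Iic t, u b • xPow F p b, fun a ha => ?_⟩
  rw [map_sum, Finset.sum_eq_single a]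
  · simp [co_xPow ha]
  · intro b _ hb
    simp [co_xPow ha, hb]
  · intro h
    exact absurd (Finset.mem_Iic.2 fun i => (ha i).le) h

theorem eq_sum_xPow [NeZero p] (f : A F p n) :
    f = ∑ b ∈ Finset.Iic (Finsupp.equivFunOnFinite.symm (tau p n) : Fin n →₀ ℕ),
      co F p b f • xPow F p b := by
  classical
  refine eq_of_co_eq fun a ha => ?_
  rw [map_sum, Finset.sum_eq_single a]
  · simp [co_xPow ha]
  · intro b _ hb
    simp [co_xPow ha, hb]
  · intro h
    exact absurd (Finset.mem_Iic.2 fun i => Nat.le_sub_one_of_lt (ha i)) h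

theorem mem_belowTau_iff [NeZero p] (f : A F p n) :
    f ∈ belowTauSubmodule F p n ↔
      co F p (Finsupp.equivFunOnFinite.symm (tau p n)) f = 0 := by
  have hp : 0 < p := NeZero.pos p
  have hlt : ∀ i, (Finsupp.equivFunOnFinite.symm (tau p n) : Fin n →₀ ℕ) i < p := by
    intro i
    simp only [Finsupp.equivFunOnFinite_symm_apply_apply, tau]
    omega
  constructor
  · intro h
    induction h using Submodule.span_induction with
    | mem g hg =>
      obtain ⟨a, -, ha, rfl⟩ := hg
      have := co_xPow (F := F) hlt (Finsupp.equivFunOnFinite.symm a)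
      rw [if_neg (fun h => ha (Finsupp.equivFunOnFinite.symm.injective h))] at this
      exact this
    | zero => simp
    | add f g _ _ hf hg => rw [map_add, hf, hg, add_zero]
    | smul c f _ hf => rw [map_smul, hf, smul_zero]
  · intro h
    rw [eq_sum_xPow f]
    refine sum_mem fun b hb => ?_
    by_cases hbt : b = Finsupp.equivFunOnFinite.symm (tau p n)
    · rw [hbt, h, zero_smul]
      exact zero_mem _
    · refine Submodule.smul_mem _ _ (Submodule.subset_span ⟨b, fun i => Finset.mem_Iic.1 hb i, ?_, rfl⟩)
      rintro hb'
      exact hbt (DFunLike.coe_injective hb')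

variable [CharP F p]

/-- The polynomial formula survives truncation: when a_i = p - 1 the factor a_i + 1 is zero in F. -/
theorem co_D (i : Fin n) (a : Fin n →₀ ℕ) (ha : ∀ j, a j < p) (f : A F p n) :
    co F p a (D F p i f) = (a i + 1) * co F p (a + Finsupp.single i 1) f := by
  obtain ⟨f, rfl⟩ := proj_surjective F p n f
  rw [D_proj, co_proj ha, coeff_pderiv]
  by_cases h : a i + 1 < p
  · rw [co_proj, mul_comm]
    intro j
    by_cases hj : j = i
    · subst hj; simpa using h
    · simpa [Finsupp.single_eq_of_ne hj] using ha j
  · have hi : a i + 1 = p := by have := ha i; omega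
    have : (a i + 1 : F) = 0 := by
      have := CharP.cast_eq_zero F p
      rw [← hi] at this
      exact_mod_cast this
    rw [this]; simp

theorem co_D_eq_zero {i : Fin n} {a : Fin n →₀ ℕ} (ha : ∀ j, a j < p) (hi : a i = p - 1)
    (f : A F p n) : co F p a (D F p i f) = 0 := by
  rw [co_D i a ha, co_eq_zero_of_le (i := i), mul_zero]
  have := ha i
  simp; omega

theorem natCast_ne_zero_of_lt {k : ℕ} (h0 : k ≠ 0) (h : k < p) : (k : F) ≠ 0 := by
  rw [Ne, CharP.cast_eq_zero_iff F p]
  exact fun hd => absurd (Nat.le_of_dvd (by omega) hd) (by omega)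

/-- A nonzero exponent a_i < p is invertible in F, so the coefficient of f at a is recovered from
that of D_i f at a - e_i. -/
theorem exists_const_of_D_eq_zero {f : A F p n} (h : ∀ i, D F p i f = 0) :
    ∃ c : F, f = algebraMap F _ c := by
  have hone : (1 : A F p n) = xPow F p (0 : Fin n →₀ ℕ) := by simp [xPow]
  refine ⟨co F p 0 f, eq_of_co_eq fun a ha => ?_⟩
  rw [Algebra.algebraMap_eq_smul_one, hone, map_smul, co_xPow ha]
  split_ifs with h0
  · simp [← h0]
  · obtain ⟨i, hi⟩ : ∃ i, a i ≠ 0 := by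
      by_contra! hc
      exact h0 (Finsupp.ext fun i => (hc i).symm)
    have hb : a - Finsupp.single i 1 + Finsupp.single i 1 = a :=
      tsub_add_cancel_of_le (Finsupp.single_le_iff.2 (by omega))
    have := co_D i (a - Finsupp.single i 1)
      (fun j => lt_of_le_of_lt (by simp) (ha j)) f
    rw [hb, h i, map_zero, eq_comm, mul_eq_zero] at this
    rcases this with h1 | h1
    · refine absurd ?_ (natCast_ne_zero_of_lt (F := F) hi (ha i))
      rw [← h1]
      have h2 : a i - 1 + 1 = a i := by omega
      have h3 : ((a i - 1 + 1 : ℕ) : F) = (a i : F) := by rw [h2]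
      simpa using h3.symm
    · simpa using h1

/-! ### Closed 1-forms on the truncated algebra -/

variable [Fact p.Prime]

/-- The first cohomology of the truncated de Rham complex is spanned by the `xᵢ^{p-1} dxᵢ`. -/
theorem exists_potential {g : Fin n → A F p n} (hg : ∀ i j, D F p i (g j) = D F p j (g i)) :
    ∃ (h : A F p n) (c : Fin n → F), ∀ i, g i = D F p i h + c i • x F p i ^ (p - 1) := by
  classical
  have hp : 1 < p := (Fact.out : p.Prime).one_lt
  have key : ∀ (i j : Fin n) (a : Fin n →₀ ℕ), (∀ k, a k < p) →
      ((a i : F) + 1) * co F p (a + Finsupp.single i 1) (g j) =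
        ((a j : F) + 1) * co F p (a + Finsupp.single j 1) (g i) := by
    intro i j a ha
    rw [← co_D i a ha, ← co_D j a ha, hg]
  -- A potential h must satisfy a_i h_a = (g_i)_{a - e_i}; divide for one chosen i with a_i ≠ 0. The
  -- constant term is free.
  let u : (Fin n →₀ ℕ) → F := fun a =>
    if h : ∃ i, a i ≠ 0 then
      ((a h.choose : F))⁻¹ * co F p (a - Finsupp.single h.choose 1) (g h.choose) else 0
  -- Closedness, read at the exponent a - e_i - e_j, makes this value independent of the chosen
  -- index.
  have hu : ∀ (a : Fin n →₀ ℕ) (i : Fin n), (∀ k, a k < p) → a i ≠ 0 →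
      (a i : F) * u a = co F p (a - Finsupp.single i 1) (g i) := by
    intro a i ha hi
    have h : ∃ i, a i ≠ 0 := ⟨i, hi⟩
    have hua : u a = ((a h.choose : F))⁻¹ * co F p (a - Finsupp.single h.choose 1) (g h.choose) :=
      dif_pos h
    rw [hua]
    have hj := h.choose_spec
    generalize h.choose = j at hj
    have hjF := natCast_ne_zero_of_lt (F := F) hj (ha j)
    by_cases hij : i = j
    · subst hij
      field_simp
    · have hk := key i j (a - Finsupp.single i 1 - Finsupp.single j 1)
        (fun k => lt_of_le_of_lt (by simp; omega) (ha k))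
      have e1 : a - Finsupp.single i 1 - Finsupp.single j 1 + Finsupp.single i 1 =
          a - Finsupp.single j 1 := by
        ext k
        simp only [Finsupp.add_apply, Finsupp.tsub_apply, Finsupp.single_apply]
        split_ifs <;> subst_vars <;> omega
      have e2 : a - Finsupp.single i 1 - Finsupp.single j 1 + Finsupp.single j 1 =
          a - Finsupp.single i 1 := by
        ext k
        simp only [Finsupp.add_apply, Finsupp.tsub_apply, Finsupp.single_apply]
        split_ifs <;> subst_vars <;> omega
      have e3 : ((a - Finsupp.single i 1 - Finsupp.single j 1 : Fin n →₀ ℕ) i : F) + 1 = a i := by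
        have : (a - Finsupp.single i 1 - Finsupp.single j 1 : Fin n →₀ ℕ) i + 1 = a i := by
          simp only [Finsupp.tsub_apply, Finsupp.single_apply, if_true, if_neg (Ne.symm hij)]
          omega
        rw [← Nat.cast_add_one, this]
      have e4 : ((a - Finsupp.single i 1 - Finsupp.single j 1 : Fin n →₀ ℕ) j : F) + 1 = a j := by
        have : (a - Finsupp.single i 1 - Finsupp.single j 1 : Fin n →₀ ℕ) j + 1 = a j := by
          simp only [Finsupp.tsub_apply, Finsupp.single_apply, if_true, if_neg hij]
          omega
        rw [← Nat.cast_add_one, this]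
      rw [e1, e2, e3, e4] at hk
      rw [mul_left_comm, hk]
      field_simp
  obtain ⟨h, hh⟩ := exists_co_eq (F := F) (p := p) u
  refine ⟨h, fun i => co F p (Finsupp.single i (p - 1)) (g i), fun i => ?_⟩
  refine eq_of_co_eq fun a ha => ?_
  rw [map_add, map_smul, ← xPow_single, co_xPow ha]
  by_cases hi : a i = p - 1
  · rw [co_D_eq_zero ha hi, zero_add]
    split_ifs with hs
    · rw [← hs]; simp
    -- With j ≠ i and a_j ≠ 0, closedness gives a_j (g_i)_a = (D_i g_j)_{a - e_j} = 0, because the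
    -- exponent of x_i is p - 1.
    · obtain ⟨j, hj⟩ : ∃ j, j ≠ i ∧ a j ≠ 0 := by
        by_contra! hc
        refine hs (Finsupp.ext fun k => ?_)
        by_cases hk : k = i
        · subst hk; simp [hi]
        · rw [hc k hk, Finsupp.single_eq_of_ne hk]
      have hb : a - Finsupp.single j 1 + Finsupp.single j 1 = a :=
        tsub_add_cancel_of_le (Finsupp.single_le_iff.2 (by omega))
      have hlt : ∀ k, (a - Finsupp.single j 1 : Fin n →₀ ℕ) k < p := fun k =>
        lt_of_le_of_lt (by simp) (ha k)
      have hk := co_D j _ hlt (g i)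
      rw [hb, hg j i, co_D_eq_zero hlt (by simp [Finsupp.single_eq_of_ne hj.1.symm, hi])] at hk
      have e4 : ((a - Finsupp.single j 1 : Fin n →₀ ℕ) j : F) + 1 = a j := by
        have : (a - Finsupp.single j 1 : Fin n →₀ ℕ) j + 1 = a j := by
          simp only [Finsupp.tsub_apply, Finsupp.single_eq_same]
          omega
        rw [← Nat.cast_add_one, this]
      rw [e4] at hk
      rw [smul_zero]
      exact (mul_eq_zero.1 hk.symm).resolve_left (natCast_ne_zero_of_lt hj.2 (ha j))
  · have hs : Finsupp.single i (p - 1) ≠ a := by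
      rintro rfl
      simp at hi
    have hlt : ∀ k, (a + Finsupp.single i 1 : Fin n →₀ ℕ) k < p := by
      intro k
      by_cases hk : k = i
      · subst hk
        have := ha k
        simp; omega
      · simpa [Finsupp.single_eq_of_ne hk] using ha k
    rw [if_neg hs, smul_zero, add_zero, co_D i a ha, hh _ hlt]
    have := hu (a + Finsupp.single i 1) i hlt (by simp)
    rw [add_tsub_cancel_right] at this
    rw [← this]
    simp

end Coefficients

end Special

namespace TruncatedFrame

/-! ### Monomials in a commutative ring -/

section Monomials

variable {R : Type*} [CommRing R] {n : ℕ} (x : Fin n → R)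

/-- The monomial `∏ xᵢ^{aᵢ}`. -/
def mon (a : Fin n → ℕ) : R := ∏ i, x i ^ a i

theorem mon_add (a b : Fin n → ℕ) : mon x (a + b) = mon x a * mon x b := by
  simp [mon, pow_add, Finset.prod_mul_distrib]

theorem mon_pi_single (i : Fin n) (k : ℕ) : mon x (Pi.single i k) = x i ^ k := by
  rw [mon, Finset.prod_eq_single i]
  · simp
  · intro j _ hj
    simp [hj]
  · simp

theorem mon_eq_pow_mul_update (a : Fin n → ℕ) (j : Fin n) :
    mon x a = x j ^ a j * mon x (Function.update a j 0) := by
  rw [← mon_pi_single, ← mon_add]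
  congr 1
  ext k
  by_cases hk : k = j
  · subst hk; simp
  · simp [hk]

end Monomials

/-! ### Divergence-free derivations and their brackets -/

section Frame

variable {F R : Type*} [Field F] [CommRing R] [Algebra F R] {n : ℕ}

/-- The derivations `∂ᵢ` behave like the partial derivatives with respect to the elements `xᵢ`
of a commutative algebra, derivations are determined by their values on the `xᵢ`, and the
monomials with exponents at most `p - 1` span the algebra. -/
structure IsFrame (F : Type*) {R : Type*} [Field F] [CommRing R] [Algebra F R] {n : ℕ} (p : ℕ)
    (x : Fin n → R) (d : Fin n → Derivation F R R) : Prop where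
  apply_x : ∀ i j, d i (x j) = if i = j then 1 else 0
  ext : ∀ E G : Derivation F R R, (∀ i, E (x i) = G (x i)) → E = G
  apply_mon : ∀ i (a : Fin n → ℕ), d i (mon x a) = (a i : F) • mon x (a - Pi.single i 1)
  mem_span : ∀ f, f ∈ Submodule.span F {g | ∃ a : Fin n → ℕ, (∀ i, a i ≤ p - 1) ∧ g = mon x a}

variable {p : ℕ} {x : Fin n → R} {d : Fin n → Derivation F R R}

variable (x d) in
/-- The derivations `∑ fᵢ ∂ᵢ` with `∑ ∂ᵢ(fᵢ) = 0`. -/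
def divFree : Submodule F (Derivation F R R) where
  carrier := {E | ∑ i, d i (E (x i)) = 0}
  add_mem' {E G} hE hG := by
    simp only [Set.mem_ofPred_eq] at hE hG ⊢
    simp [Finset.sum_add_distrib, hE, hG]
  zero_mem' := by simp
  smul_mem' c E hE := by
    simp only [Set.mem_ofPred_eq] at hE ⊢
    simp [← Finset.smul_sum, hE]

variable (x d) in
/-- The span of all brackets of divergence-free derivations. -/
def special : Submodule F (Derivation F R R) :=
  Submodule.span F {G | ∃ a ∈ divFree x d, ∃ b ∈ divFree x d, ⁅a, b⁆ = G}

variable (d) in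
/-- The divergence-free derivation `∂ⱼ(f) ∂ᵢ - ∂ᵢ(f) ∂ⱼ`. -/
def Dpair (i j : Fin n) : R →ₗ[F] Derivation F R R where
  toFun f := d j f • d i - d i f • d j
  map_add' f g := by simp only [map_add, add_smul]; abel
  map_smul' c f := by
    simp only [Derivation.map_smul, RingHom.id_apply, smul_sub, smul_assoc]

theorem Dpair_apply (i j : Fin n) (f : R) : Dpair d i j f = d j f • d i - d i f • d j := rfl

theorem Dpair_swap (i j : Fin n) (f : R) : Dpair d i j f = -Dpair d j i f := by
  simp [Dpair_apply]

theorem Dpair_self (i : Fin n) (f : R) : Dpair d i i f = 0 := by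
  simp [Dpair_apply]

namespace IsFrame

variable (h : IsFrame F p x d)
include h

theorem comm (i j : Fin n) (f : R) : d i (d j f) = d j (d i f) := by
  have : ⁅d i, d j⁆ = (0 : Derivation F R R) := by
    refine h.ext _ _ fun k => ?_
    rw [Derivation.commutator_apply, h.apply_x, h.apply_x]
    split_ifs <;> simp
  have h := congrArg (fun E : Derivation F R R => E f) this
  simpa [Derivation.commutator_apply, sub_eq_zero] using h

theorem apply_eq_sum (E : Derivation F R R) (f : R) : E f = ∑ i, E (x i) * d i f := by
  have hs : ∀ g, (∑ i, E (x i) • d i) g = ∑ i, E (x i) * d i g := by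
    intro g
    rw [← Derivation.coeFnAddMonoidHom_apply, map_sum, Finset.sum_apply]
    rfl
  have : E = ∑ i, E (x i) • d i := by
    refine h.ext _ _ fun j => ?_
    rw [hs]
    simp [h.apply_x]
  rw [← hs, ← this]

theorem x_mul_apply_mon (i : Fin n) (a : Fin n → ℕ) :
    x i * d i (mon x a) = (a i : F) • mon x a := by
  rw [h.apply_mon, mul_smul_comm]
  rcases Nat.eq_zero_or_pos (a i) with h0 | h0
  · simp [h0]
  · congr 1
    rw [← pow_one (x i), ← mon_pi_single, ← mon_add]
    congr 1
    ext j
    by_cases hj : j = i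
    · subst hj; simp; omega
    · simp [hj]

theorem apply_mon_eq_zero {i : Fin n} {a : Fin n → ℕ} (h0 : a i = 0) : d i (mon x a) = 0 := by
  rw [h.apply_mon, h0, Nat.cast_zero, zero_smul]

theorem lie_smul_smul (i j : Fin n) (f g : R) :
    ⁅f • d i, g • d j⁆ = (f * d i g) • d j - (g * d j f) • d i := by
  ext k
  simp only [Derivation.commutator_apply, Derivation.smul_apply, Derivation.sub_apply,
    Derivation.leibniz, smul_eq_mul, h.comm j i]
  ring

theorem lie_smul (i j : Fin n) (g : R) : ⁅d i, g • d j⁆ = d i g • d j := by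
  simpa using h.lie_smul_smul i j 1 g

/-- Weights: x^a ∂_j is an eigenvector of the torus element x_k ∂_k, with eigenvalue the k-th entry
of a - e_j. -/
theorem lie_x_smul_mon_smul (k j : Fin n) (a : Fin n → ℕ) :
    ⁅x k • d k, mon x a • d j⁆ = ((a k : F) - if k = j then 1 else 0) • (mon x a • d j) := by
  rw [h.lie_smul_smul, h.x_mul_apply_mon, h.apply_x]
  by_cases hk : k = j
  · subst hk
    simp [sub_smul]
  · simp [hk, Ne.symm hk]

theorem smul_mem_divFree {i : Fin n} {f : R} (hf : d i f = 0) : f • d i ∈ divFree x d := by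
  change ∑ j, d j ((f • d i) (x j)) = 0
  rw [Finset.sum_eq_single i]
  · simp [h.apply_x, hf]
  · intro j _ hj
    simp [h.apply_x, hj.symm]
  · simp

theorem lie_Dpair (k i j : Fin n) (f : R) : ⁅d k, Dpair d i j f⁆ = Dpair d i j (d k f) := by
  rw [Dpair_apply, lie_sub, h.lie_smul, h.lie_smul, Dpair_apply, h.comm k, h.comm k i]

/-- Source of brackets: any monomial splits as a power of x_j, killed by ∂_i, times a factor killed
by ∂_j, which places its `Dpair` in the special algebra. -/
theorem Dpair_mul {i j : Fin n} {f g : R} (hf : d i f = 0) (hg : d j g = 0) :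
    Dpair d i j (f * g) = -⁅f • d i, g • d j⁆ := by
  simp [Dpair_apply, h.lie_smul_smul, Derivation.leibniz, hf, hg]

theorem apply_x_pow_eq_zero {i j : Fin n} (hij : i ≠ j) (k : ℕ) : d i (x j ^ k) = 0 := by
  simp [Derivation.leibniz_pow, h.apply_x, hij]

theorem Dpair_mon {i j : Fin n} (hij : i ≠ j) (a : Fin n → ℕ) :
    Dpair d i j (mon x a) = -⁅x j ^ a j • d i, mon x (Function.update a j 0) • d j⁆ := by
  rw [mon_eq_pow_mul_update x a j,
    h.Dpair_mul (h.apply_x_pow_eq_zero hij _) (h.apply_mon_eq_zero (by simp))]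

theorem Dpair_mon_mem {i j : Fin n} (hij : i ≠ j) (a : Fin n → ℕ) :
    Dpair d i j (mon x a) ∈ special x d := by
  rw [h.Dpair_mon hij]
  exact neg_mem (Submodule.subset_span ⟨_, h.smul_mem_divFree (h.apply_x_pow_eq_zero hij _),
    _, h.smul_mem_divFree (h.apply_mon_eq_zero (by simp)), rfl⟩)

/-- For divergence-free E one has E f = ∑ ∂_i(E(x_i) f), so the components of a bracket are total
derivatives that pair up antisymmetrically. -/
theorem lie_eq_sum_Dpair {E G : Derivation F R R} (hE : E ∈ divFree x d)
    (hG : G ∈ divFree x d) : ⁅E, G⁆ = ∑ i, ∑ j, Dpair d j i (E (x i) * G (x j)) := by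
  have key : ∀ {E : Derivation F R R} (_ : E ∈ divFree x d) (f : R),
      E f = ∑ i, d i (E (x i) * f) := by
    intro E hE f
    have hE' : ∑ i, d i (E (x i)) = 0 := hE
    simp only [Derivation.leibniz, smul_eq_mul, Finset.sum_add_distrib, ← Finset.mul_sum, hE']
    rw [h.apply_eq_sum]; simp
  have happ : ∀ (T : Fin n → Fin n → Derivation F R R) (f : R),
      (∑ i, ∑ j, T i j) f = ∑ i, ∑ j, T i j f := by
    intro T f
    rw [← Derivation.coeFnAddMonoidHom_apply]
    simp only [map_sum, Finset.sum_apply]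
    rfl
  refine h.ext _ _ fun k => ?_
  rw [happ, Derivation.commutator_apply, key hE (G (x k)), key hG (E (x k))]
  simp only [Dpair_apply, Derivation.sub_apply, Derivation.smul_apply, h.apply_x, smul_eq_mul,
    mul_ite, mul_one, mul_zero, Finset.sum_sub_distrib]
  congr 1
  · simp
  · rw [Finset.sum_comm]
    simp [mul_comm]

/-! ### The vanishing criterion -/

variable [CharP F p]

/-- Integrating in x_k, `Dpair d j k` of x^{a + e_k} is (a_k + 1) x^a ∂_j, and a_k + 1 < p is a
unit. -/
theorem mon_smul_mem {j k : Fin n} (hjk : k ≠ j) {a : Fin n → ℕ} (hj : a j = 0)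
    (hk : a k < p - 1) : mon x a • d j ∈ special x d := by
  have hm := h.Dpair_mon_mem hjk.symm (a + Pi.single k 1)
  rw [Dpair_apply, h.apply_mon_eq_zero (i := j) (by simp [hj, hjk.symm]), h.apply_mon] at hm
  simp only [zero_smul, sub_zero, add_tsub_cancel_right, smul_assoc] at hm
  refine (Submodule.smul_mem_iff _ (Special.natCast_ne_zero_of_lt (p := p) ?_ ?_)).1 hm
  · simp
  · simp; omega

omit [CharP F p] in
/-- The special derivations lie in every subspace containing all `Dᵢⱼ(x^a)`, `a ≤ τ`. -/
theorem special_le {N : Submodule F (Derivation F R R)}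
    (hN : ∀ i j : Fin n, i ≠ j → ∀ a : Fin n → ℕ, (∀ k, a k ≤ p - 1) →
      Dpair d i j (mon x a) ∈ N) : special x d ≤ N := by
  refine Submodule.span_le.2 ?_
  rintro _ ⟨E, hE, G, hG, rfl⟩
  rw [h.lie_eq_sum_Dpair hE hG]
  refine sum_mem fun i _ => sum_mem fun j _ => ?_
  by_cases hij : j = i
  · subst hij
    rw [Dpair_self]
    exact zero_mem _
  · generalize E (x i) * G (x j) = f
    have hf := h.mem_span f
    induction hf using Submodule.span_induction with
    | mem g hg =>
      obtain ⟨a, ha, rfl⟩ := hg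
      exact hN j i hij a ha
    | zero => rw [map_zero]; exact zero_mem _
    | add f g _ _ hf hg => rw [map_add]; exact add_mem hf hg
    | smul c f _ hf => rw [map_smul]; exact N.smul_mem _ hf

/-- Abstract vanishing criterion: `N` plays the role of the kernel of a cocycle, `C` that of the
preimage of the constants. -/
theorem special_le_of_lie_mem (hp3 : 3 ≤ p) (hn : 3 ≤ n) {N C : Submodule F (Derivation F R R)}
    (hNC : N ≤ C) (hlie : ∀ E ∈ C, ∀ G ∈ C, ⁅E, G⁆ ∈ N) (hD : ∀ i, d i ∈ N)
    (hC : ∀ E ∈ special x d, (∀ i, ⁅d i, E⁆ ∈ N) → E ∈ C) : special x d ≤ N := by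
  have third : ∀ i j : Fin n, ∃ k, k ≠ i ∧ k ≠ j := by
    intro i j
    obtain ⟨k, hk⟩ : ∃ k, k ∉ ({i, j} : Finset (Fin n)) := by
      by_contra! hc
      have h1 : (Finset.univ : Finset (Fin n)) ⊆ {i, j} := fun k _ => hc k
      have h2 := (Finset.card_le_card h1).trans Finset.card_le_two
      rw [Finset.card_univ, Fintype.card_fin] at h2
      omega
    exact ⟨k, by simpa [not_or] using hk⟩
  have eigen : ∀ H ∈ N, ∀ E ∈ C, ∀ c : F, c ≠ 0 → ⁅H, E⁆ = c • E → E ∈ N := by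
    intro H hH E hE c hc he
    have := hlie H (hNC hH) E hE
    rwa [he, N.smul_mem_iff hc] at this
  have hxC : ∀ i j : Fin n, i ≠ j → x i • d j ∈ C := by
    intro i j hij
    refine hC _ ?_ fun k => ?_
    -- The exponent 1 must be below p - 1, which excludes p = 2.
    · have := h.mon_smul_mem (j := j) (k := i) hij
        (a := Pi.single i 1) (by simp [hij.symm]) (by simp; omega)
      rwa [mon_pi_single, pow_one] at this
    · rw [h.lie_smul, h.apply_x]
      split_ifs
      · simpa using hD j
      · simp
  have htorus : ∀ i j : Fin n, i ≠ j → x i • d i - x j • d j ∈ N := by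
    intro i j hij
    have := hlie _ (hxC i j hij) _ (hxC j i hij.symm)
    simpa [h.lie_smul_smul, h.apply_x] using this
  have hmono : ∀ (m : ℕ) (j k : Fin n) (a : Fin n → ℕ), ∑ i, a i = m → k ≠ j → a j = 0 →
      a k < p - 1 → mon x a • d j ∈ N := by
    intro m
    induction m using Nat.strong_induction_on with
    | _ m ih =>
      intro j k a hm hkj hj hk
      -- Bracketing with ∂_i lowers the degree, so the induction hypothesis puts x^a ∂_j in C. Its
      -- weight under x_j ∂_j - x_k ∂_k is -1 - a_k, nonzero since a_k < p - 1.
      refine eigen _ (htorus j k hkj.symm) _ (hC _ (h.mon_smul_mem hkj hj hk) fun i => ?_)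
        (-((a k + 1 : ℕ) : F)) (neg_ne_zero.2 (Special.natCast_ne_zero_of_lt (p := p) (by simp)
          (by omega))) ?_
      · rw [h.lie_smul, h.apply_mon, smul_assoc]
        rcases Nat.eq_zero_or_pos (a i) with h0 | h0
        · simp [h0]
        · refine N.smul_mem _ (ih _ ?_ j k _ rfl hkj (by simp [hj])
            (lt_of_le_of_lt (by simp) hk))
          rw [← hm]
          refine Finset.sum_lt_sum (fun l _ => by simp) ⟨i, Finset.mem_univ i, by simp; omega⟩
      · rw [sub_lie, h.lie_x_smul_mon_smul, h.lie_x_smul_mon_smul, ← sub_smul, if_pos rfl,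
          if_neg hkj, hj]
        congr 1
        push_cast
        ring
  have hpair_aux : ∀ (i j k : Fin n) (a : Fin n → ℕ), i ≠ j → k ≠ j → a k < p - 1 →
      Dpair d i j (mon x a) ∈ N := by
    intro i j k a hij hkj hk
    -- The factor x_j^{a_j} ∂_i may have a_j = p - 1, so a third index, with exponent 0, is used to
    -- put it in N.
    obtain ⟨l, hli, hlj⟩ := third i j
    rw [h.Dpair_mon hij]
    refine neg_mem (hlie _ (hNC ?_) _ (hNC ?_))
    · rw [← mon_pi_single]
      exact hmono _ i l _ rfl hli (by simp [hij]) (by simp [hlj]; omega)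
    · exact hmono _ j k _ rfl hkj (by simp) (by simpa [hkj] using hk)
  have hpair : ∀ (i j k : Fin n) (a : Fin n → ℕ), i ≠ j → a k < p - 1 →
      Dpair d i j (mon x a) ∈ N := by
    intro i j k a hij hk
    by_cases hkj : k = j
    · subst hkj
      rw [Dpair_swap]
      exact neg_mem (hpair_aux k i k a hij.symm hij.symm hk)
    · exact hpair_aux i j k a hij hkj hk
  refine h.special_le fun i j hij a ha => ?_
  by_cases hat : ∃ k, a k < p - 1
  · obtain ⟨k, hk⟩ := hat
    exact hpair i j k a hij hk
  · replace ha : ∀ k, a k = p - 1 := by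
      push Not at hat
      exact fun k => le_antisymm (ha k) (hat k)
    -- Only a = τ is left. For a third index k, x_i ∂_i - x_k ∂_k acts on it by (p - 2) - (p - 1) =
    -- -1.
    obtain ⟨k, hki, hkj⟩ := third i j
    refine eigen _ (htorus i k hki.symm) _ (hC _ (h.Dpair_mon_mem hij _) fun m => ?_) (-1)
      (by simp) ?_
    · rw [h.lie_Dpair, h.apply_mon, map_smul]
      exact N.smul_mem _ (hpair i j m _ hij (by simp [ha]; omega))
    · have hcast : ((p - 1 - 1 : ℕ) : F) = ((p - 1 : ℕ) : F) - 1 := by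
        rw [Nat.cast_sub (by omega), Nat.cast_one]
      have hsmul : ∀ (E G : Derivation F R R) (c : F), ⁅E, c • G⁆ = c • ⁅E, G⁆ := by
        intro E G c
        ext f
        simp [Derivation.commutator_apply, smul_sub]
      simp only [Dpair_apply, h.apply_mon, smul_assoc, lie_sub, hsmul, sub_lie,
        h.lie_x_smul_mon_smul]
      simp only [Pi.sub_apply, Pi.single_apply, ha, hki, hkj, hij,
        if_true, if_false, tsub_zero, hcast, ← sub_smul, smul_sub, smul_smul]
      congr 2 <;> ring

end IsFrame

end Frame

end TruncatedFrame

/-! ### Cocycles of S(n) and their rigidity -/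

namespace Special

variable {F : Type*} [Field F] {p n : ℕ} [CharP F p]

theorem D_xPow (i : Fin n) (a : Fin n → ℕ) :
    D F p i (xPow F p a) = (a i : F) • xPow F p (a - Pi.single i 1) := by
  have h : xPow F p a = proj F p n (monomial (Finsupp.equivFunOnFinite.symm a) 1) := by
    rw [proj_monomial, one_smul]; rfl
  rw [h, D_proj, pderiv_monomial, proj_monomial, one_mul]
  congr 2
  ext j
  simp [Finsupp.single_apply, Pi.single_apply, eq_comm]

theorem isFrame [NeZero p] : TruncatedFrame.IsFrame F p (x F p) (D F p (n := n)) where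
  apply_x := D_x
  ext E G := W_ext (E := E) (G := G)
  apply_mon := D_xPow
  mem_span f := by
    have hf := eq_sum_xPow f
    rw [hf]
    refine sum_mem fun b hb => Submodule.smul_mem _ _ (Submodule.subset_span ⟨b, fun i => ?_, rfl⟩)
    exact Finset.mem_Iic.1 hb i

theorem mem_S_iff_special (E : W F p n) :
    E ∈ S F p n ↔ E ∈ TruncatedFrame.special (F := F) (x F p) (D F p (n := n)) :=
  mem_S_iff E

variable [Fact p.Prime]

theorem mem_Z_iff (φ : LieModule.Cohomology.oneCochain F (S F p n) (belowTau F p n)) :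
    φ ∈ LieH1.Z F (S F p n) (belowTau F p n) ↔
      ∀ E G : S F p n, (φ ⁅E, G⁆ : A F p n) = E.1 (φ G : A F p n) - G.1 (φ E : A F p n) := by
  rw [LieH1.Z, LinearMap.mem_ker]
  constructor
  · intro h E G
    have h1 := congrArg (fun f => ((f E G : belowTau F p n) : A F p n)) h
    exact (sub_eq_zero.1 h1).symm
  · intro h
    ext E G
    refine Eq.trans ?_ (sub_eq_zero.2 (h E G).symm)
    rfl

/-- χ_i contracts E with the closed form x_i^{p-1} dx_i: the Leibniz terms containing E(x_i) G(x_i)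
are symmetric in E and G and cancel. -/
theorem chi_mem_Z (i : Fin n) : chi F p i ∈ LieH1.Z F (S F p n) (belowTau F p n) := by
  rw [mem_Z_iff]
  intro E G
  change ⁅E.1, G.1⁆ (x F p i) * x F p i ^ (p - 1) =
    E.1 (G.1 (x F p i) * x F p i ^ (p - 1)) - G.1 (E.1 (x F p i) * x F p i ^ (p - 1))
  simp only [Derivation.commutator_apply, Derivation.leibniz, Derivation.leibniz_pow,
    smul_eq_mul, nsmul_eq_mul]
  ring

/-- This is the coboundary of x^τ in A(n), and x^τ is missing from A(n)_{<τ}. -/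
theorem adTau_mem_Z : adTau F p n ∈ LieH1.Z F (S F p n) (belowTau F p n) := by
  rw [mem_Z_iff]
  intro E G
  change ⁅E.1, G.1⁆ (xPow F p (tau p n)) = _
  rw [Derivation.commutator_apply]
  rfl

/-- A cocycle of `S(n)` that vanishes on all `Dᵢ` is zero. -/
theorem eq_zero_of_apply_D_eq_zero (hp : p ≠ 2) (hn : 3 ≤ n)
    {φ : LieModule.Cohomology.oneCochain F (S F p n) (belowTau F p n)}
    (hφ : φ ∈ LieH1.Z F (S F p n) (belowTau F p n))
    (hD : ∀ i, ∃ h : D F p i ∈ S F p n, φ ⟨D F p i, h⟩ = 0) : φ = 0 := by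
  rw [mem_Z_iff] at hφ
  have hp3 : 3 ≤ p := by
    have := (Fact.out : p.Prime).two_le
    omega
  let N : Submodule F (W F p n) :=
    { carrier := {E | ∃ h : E ∈ S F p n, φ ⟨E, h⟩ = 0}
      add_mem' := by
        rintro E G ⟨hE, h1⟩ ⟨hG, h2⟩
        exact ⟨add_mem hE hG, (map_add φ ⟨E, hE⟩ ⟨G, hG⟩).trans (by rw [h1, h2, add_zero])⟩
      zero_mem' := ⟨zero_mem _, map_zero φ⟩
      smul_mem' := by
        rintro c E ⟨hE, h1⟩
        exact ⟨(S F p n).smul_mem c hE,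
          (map_smul φ c ⟨E, hE⟩).trans (by rw [h1, smul_zero])⟩ }
  let C : Submodule F (W F p n) :=
    { carrier := {E | ∃ (h : E ∈ S F p n) (c : F), (φ ⟨E, h⟩ : A F p n) = algebraMap F _ c}
      add_mem' := by
        rintro E G ⟨hE, c, h1⟩ ⟨hG, c', h2⟩
        refine ⟨add_mem hE hG, c + c', ?_⟩
        rw [map_add (algebraMap F (A F p n)), ← h1, ← h2]
        exact congrArg Subtype.val (map_add φ ⟨E, hE⟩ ⟨G, hG⟩)
      zero_mem' := ⟨zero_mem _, 0, (congrArg Subtype.val (map_zero φ)).trans (by simp)⟩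
      smul_mem' := by
        rintro c E ⟨hE, c', h1⟩
        refine ⟨(S F p n).smul_mem c hE, c * c', ?_⟩
        rw [map_mul, ← h1, ← Algebra.smul_def]
        exact congrArg Subtype.val (map_smul φ c ⟨E, hE⟩) }
  have hNC : N ≤ C := by
    rintro E ⟨hE, h⟩
    exact ⟨hE, 0, by rw [h]; simp⟩
  have key : TruncatedFrame.special (x F p) (D F p (n := n)) ≤ N := by
    refine isFrame.special_le_of_lie_mem hp3 hn hNC ?_ hD ?_
    · rintro E ⟨hE, c, h1⟩ G ⟨hG, c', h2⟩
      refine ⟨(S F p n).lie_mem hE hG, Subtype.ext ?_⟩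
      refine (hφ ⟨E, hE⟩ ⟨G, hG⟩).trans ?_
      rw [h1, h2]
      simp
    · intro E hE h
      rw [← mem_S_iff_special] at hE
      -- Since φ(D_i) = 0, the cocycle identity reads D_i φ(E) = φ([D_i, E]) = 0.
      refine ⟨hE, exists_const_of_D_eq_zero fun i => ?_⟩
      obtain ⟨hi, hi0⟩ := hD i
      obtain ⟨_, h0⟩ := h i
      have h3 := hφ ⟨D F p i, hi⟩ ⟨E, hE⟩
      rw [hi0] at h3
      have h4 := (congrArg Subtype.val h0).symm.trans h3
      simpa using h4.symm
  refine LinearMap.ext fun E => ?_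
  exact (key ((mem_S_iff_special _).1 E.2)).2

end Special

/-! ### Bases of a quotient from representatives -/

namespace Submodule

variable {K M ι : Type*} [Ring K] [AddCommGroup M] [Module K M] [Fintype ι]
  {P : Submodule K M} {z : ι → M}

theorem linearIndependent_mkQ
    (h : ∀ g : ι → K, ∑ s, g s • z s ∈ P → ∀ s, g s = 0) :
    LinearIndependent K fun s => P.mkQ (z s) := by
  rw [Fintype.linearIndependent_iff]
  intro g hg
  simp only [← map_smul, ← map_sum] at hg
  exact h g ((Submodule.Quotient.mk_eq_zero P).1 hg)

theorem span_range_mkQ (h : ∀ m, ∃ g : ι → K, m - ∑ s, g s • z s ∈ P) :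
    ⊤ ≤ Submodule.span K (Set.range fun s => P.mkQ (z s)) := by
  rintro q -
  obtain ⟨m, rfl⟩ := P.mkQ_surjective q
  obtain ⟨g, hg⟩ := h m
  rw [Submodule.mkQ_apply, (Submodule.Quotient.eq P).2 hg, ← Submodule.mkQ_apply, map_sum]
  refine sum_mem fun s _ => ?_
  rw [map_smul]
  exact Submodule.smul_mem _ _ (Submodule.subset_span ⟨s, rfl⟩)

end Submodule

/-! ### Independence and spanning of the basic classes -/

namespace Special

variable {F : Type*} [Field F] {p n : ℕ} [CharP F p] [Fact p.Prime]

theorem D_mem_S (hn : 3 ≤ n) (i : Fin n) : D F p i ∈ S F p n := by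
  have : Nontrivial (Fin n) := Fin.nontrivial_iff_two_le.2 (by omega)
  obtain ⟨j, hj⟩ := exists_ne i
  have hp := (Fact.out : p.Prime).two_le
  have h := isFrame (F := F) (p := p).mon_smul_mem hj (a := 0) rfl (by simp; omega)
  rw [mem_S_iff_special]
  convert h using 1
  simp only [TruncatedFrame.mon, Pi.zero_apply, pow_zero, Finset.prod_const_one]
  exact (one_smul _ (D F p i)).symm

variable (F p n) in
/-- The cocycles `χ₁, …, χₙ` and `ad(x^τ)`. -/
def basicCocycle : Fin n ⊕ Unit → LieH1.Z F (S F p n) (belowTau F p n) :=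
  Sum.elim (fun i => ⟨chi F p i, chi_mem_Z i⟩) fun _ => ⟨adTau F p n, adTau_mem_Z⟩

theorem sum_basicCocycle_apply_D (g : Fin n ⊕ Unit → F) (k : Fin n) (hk : D F p k ∈ S F p n) :
    (((∑ s, g s • basicCocycle F p n s : LieH1.Z F (S F p n) (belowTau F p n)) :
      LieModule.Cohomology.oneCochain F (S F p n) (belowTau F p n)) ⟨D F p k, hk⟩ : A F p n) =
      g (Sum.inl k) • x F p k ^ (p - 1) +
        g (Sum.inr ()) • D F p k (xPow F p (tau p n)) := by
  let ev : LieH1.Z F (S F p n) (belowTau F p n) →ₗ[F] A F p n :=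
    (belowTauSubmodule F p n).subtype ∘ₗ
      (LinearMap.applyₗ (⟨D F p k, hk⟩ : S F p n)) ∘ₗ Submodule.subtype _
  have hchi : ∀ i, ev (basicCocycle F p n (Sum.inl i)) =
      if k = i then x F p k ^ (p - 1) else 0 := by
    intro i
    change D F p k (x F p i) * x F p i ^ (p - 1) = _
    rw [D_x]
    split_ifs with h
    · rw [h, one_mul]
    · rw [zero_mul]
  have had : ev (basicCocycle F p n (Sum.inr ())) = D F p k (xPow F p (tau p n)) := rfl
  change ev (∑ s, g s • basicCocycle F p n s) = _
  rw [map_sum, Fintype.sum_sum_type]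
  simp only [map_smul, hchi, Finset.univ_unique, Finset.sum_singleton]
  congr 1
  simp

omit [CharP F p] in
theorem xPow_tau_co :
    co F p (Finsupp.equivFunOnFinite.symm (tau p n)) (xPow F p (tau p n)) = 1 := by
  have hp := (Fact.out : p.Prime).pos
  have := co_xPow (F := F) (p := p) (a := Finsupp.equivFunOnFinite.symm (tau p n))
    (fun i => by simp only [Finsupp.equivFunOnFinite_symm_apply_apply, tau]; omega)
    (Finsupp.equivFunOnFinite.symm (tau p n))
  rw [if_pos rfl] at this
  exact this

/-- Comparing coefficients at x_k^{p-1}, which D_k never produces, kills c_k. Then m - l x^τ is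
constant, and its x^τ-coefficient kills l. -/
theorem coeff_eq_zero_of_D_eq (hn : 1 ≤ n) {m : A F p n} (hm : m ∈ belowTauSubmodule F p n)
    {c : Fin n → F} {l : F}
    (h : ∀ k, D F p k m = c k • x F p k ^ (p - 1) + l • D F p k (xPow F p (tau p n))) :
    (∀ k, c k = 0) ∧ l = 0 := by
  have hp := (Fact.out : p.Prime).two_le
  have h' : ∀ k, D F p k (m - l • xPow F p (tau p n)) = c k • x F p k ^ (p - 1) := by
    intro k
    rw [map_sub, Derivation.map_smul, h k, add_sub_cancel_right]
  have hc : ∀ k, c k = 0 := by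
    intro k
    have hlt : ∀ j, (Finsupp.single k (p - 1) : Fin n →₀ ℕ) j < p := by
      intro j
      rw [Finsupp.single_apply]
      split_ifs <;> omega
    have h1 := congrArg (co F p (Finsupp.single k (p - 1))) (h' k)
    rw [co_D_eq_zero hlt (by simp), map_smul, ← xPow_single, co_xPow hlt, if_pos rfl,
      smul_eq_mul, mul_one] at h1
    exact h1.symm
  refine ⟨hc, ?_⟩
  obtain ⟨γ, hγ⟩ := exists_const_of_D_eq_zero (f := m - l • xPow F p (tau p n))
    fun k => by rw [h' k, hc k, zero_smul]
  have h1 := congrArg (co F p (Finsupp.equivFunOnFinite.symm (tau p n))) hγ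
  -- Constants lie in A(n)_{<τ} because τ ≠ 0, as n ≥ 1 and p ≥ 2.
  have hone : algebraMap F (A F p n) γ ∈ belowTauSubmodule F p n := by
    rw [Algebra.algebraMap_eq_smul_one]
    refine Submodule.smul_mem _ _ (Submodule.subset_span ⟨0, fun i => Nat.zero_le _, fun h0 => ?_,
      by simp [xPow]⟩)
    have := congrFun h0 ⟨0, hn⟩
    simp only [Pi.zero_apply, tau] at this
    omega
  rw [map_sub, map_smul, (mem_belowTau_iff _).1 hm, (mem_belowTau_iff _).1 hone, xPow_tau_co] at h1
  simpa using h1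

theorem basicCocycle_coeff_eq_zero (hn : 3 ≤ n) (g : Fin n ⊕ Unit → F)
    (hg : (∑ s, g s • basicCocycle F p n s) ∈
      (LieH1.B F (S F p n) (belowTau F p n)).submoduleOf (LieH1.Z F (S F p n) (belowTau F p n))) :
    ∀ s, g s = 0 := by
  obtain ⟨m, hm⟩ := hg
  have hmk : ∀ k, D F p k (m : A F p n) = g (Sum.inl k) • x F p k ^ (p - 1) +
      g (Sum.inr ()) • D F p k (xPow F p (tau p n)) := by
    intro k
    rw [← sum_basicCocycle_apply_D g k (D_mem_S hn k)]
    exact congrArg Subtype.val (LinearMap.congr_fun hm ⟨D F p k, D_mem_S hn k⟩)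
  have h := coeff_eq_zero_of_D_eq (by omega) m.2 hmk
  rintro (k | u)
  · exact h.1 k
  · exact h.2

theorem D_apply_cocycle_comm (hn : 3 ≤ n)
    {φ : LieModule.Cohomology.oneCochain F (S F p n) (belowTau F p n)}
    (hφ : φ ∈ LieH1.Z F (S F p n) (belowTau F p n)) (i j : Fin n) :
    D F p i (φ ⟨D F p j, D_mem_S hn j⟩ : A F p n) =
      D F p j (φ ⟨D F p i, D_mem_S hn i⟩ : A F p n) := by
  have h1 := (mem_Z_iff φ).1 hφ ⟨D F p i, D_mem_S hn i⟩ ⟨D F p j, D_mem_S hn j⟩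
  have h0 : ⁅(⟨D F p i, D_mem_S hn i⟩ : S F p n), (⟨D F p j, D_mem_S hn j⟩ : S F p n)⁆ = 0 := by
    refine Subtype.ext (Derivation.ext fun f => ?_)
    change ⁅D F p i, D F p j⁆ f = 0
    rw [Derivation.commutator_apply, D_comm, sub_self]
  rw [h0, map_zero] at h1
  exact sub_eq_zero.1 h1.symm

/-- By rigidity, a cocycle is determined by its values on the D_k, so agreeing there with a
coboundary suffices. -/
theorem mem_B_of_apply_D (hp : p ≠ 2) (hn : 3 ≤ n) (m : belowTau F p n)
    {ψ : LieModule.Cohomology.oneCochain F (S F p n) (belowTau F p n)}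
    (hψ : ψ ∈ LieH1.Z F (S F p n) (belowTau F p n))
    (h : ∀ k, (ψ ⟨D F p k, D_mem_S hn k⟩ : A F p n) = D F p k (m : A F p n)) :
    ψ ∈ LieH1.B F (S F p n) (belowTau F p n) := by
  have hB : LieH1.d₀₁ F (S F p n) (belowTau F p n) m ∈ LieH1.Z F (S F p n) (belowTau F p n) :=
    LieH1.B_le_Z _ _ _ ⟨m, rfl⟩
  have h0 : ψ - LieH1.d₀₁ F (S F p n) (belowTau F p n) m = 0 :=
    eq_zero_of_apply_D_eq_zero hp hn (sub_mem hψ hB) fun k =>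
      ⟨D_mem_S hn k, Subtype.ext (sub_eq_zero.2 (h k))⟩
  exact ⟨m, (sub_eq_zero.1 h0).symm⟩

/-- The potential h is split as m + l x^τ, where l is its top coefficient. -/
theorem exists_potential_mem_belowTau {g : Fin n → A F p n}
    (hg : ∀ i j, D F p i (g j) = D F p j (g i)) :
    ∃ (c : Fin n → F) (l : F) (m : belowTau F p n), ∀ k,
      g k - (c k • x F p k ^ (p - 1) + l • D F p k (xPow F p (tau p n))) =
        D F p k (m : A F p n) := by
  obtain ⟨h, c, hc⟩ := exists_potential hg
  have hm : h - co F p (Finsupp.equivFunOnFinite.symm (tau p n)) h • xPow F p (tau p n) ∈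
      belowTauSubmodule F p n := by
    rw [mem_belowTau_iff, map_sub, map_smul, xPow_tau_co, smul_eq_mul, mul_one, sub_self]
  refine ⟨c, co F p (Finsupp.equivFunOnFinite.symm (tau p n)) h, ⟨_, hm⟩, fun k => ?_⟩
  rw [hc k, map_sub, Derivation.map_smul, add_comm (c k • _), add_sub_add_right_eq_sub]

theorem sub_mem_B_of_apply_D (hp : p ≠ 2) (hn : 3 ≤ n) (m : belowTau F p n)
    (φ ψ : LieH1.Z F (S F p n) (belowTau F p n))
    (h : ∀ k, (φ.1 ⟨D F p k, D_mem_S hn k⟩ : A F p n) - (ψ.1 ⟨D F p k, D_mem_S hn k⟩ : A F p n) =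
      D F p k (m : A F p n)) :
    φ - ψ ∈ (LieH1.B F (S F p n) (belowTau F p n)).submoduleOf
        (LieH1.Z F (S F p n) (belowTau F p n)) := by
  have hB : (φ - ψ).1 ∈ LieH1.B F (S F p n) (belowTau F p n) :=
    mem_B_of_apply_D hp hn m (φ - ψ).2 h
  exact hB

theorem exists_sub_basicCocycle_mem_B (hp : p ≠ 2) (hn : 3 ≤ n)
    (φ : LieH1.Z F (S F p n) (belowTau F p n)) :
    ∃ g : Fin n ⊕ Unit → F, φ - ∑ s, g s • basicCocycle F p n s ∈
      (LieH1.B F (S F p n) (belowTau F p n)).submoduleOf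
        (LieH1.Z F (S F p n) (belowTau F p n)) := by
  obtain ⟨c, l, m, h⟩ := exists_potential_mem_belowTau (D_apply_cocycle_comm hn φ.2)
  refine ⟨Sum.elim c fun _ => l, sub_mem_B_of_apply_D hp hn m _ _ fun k => ?_⟩
  have hs := sum_basicCocycle_apply_D (Sum.elim c fun _ => l) k (D_mem_S (F := F) (p := p) hn k)
  refine Eq.trans ?_ (h k)
  exact congrArg (fun f => (φ.1 ⟨D F p k, D_mem_S hn k⟩ : A F p n) - f) hs

end Special

end

theorem proposition4p6 (F : Type*) [Field F] (p : ℕ) [Fact p.Prime] [CharP F p] (hp : p ≠ 2)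
    (n : ℕ) (hn : 3 ≤ n) :
    ∃ (hchi : ∀ i : Fin n,
          Special.chi F p i ∈ LieH1.Z F (Special.S F p n) (Special.belowTau F p n))
      (hadTau : Special.adTau F p n ∈ LieH1.Z F (Special.S F p n) (Special.belowTau F p n))
      (b : Module.Basis (Fin n ⊕ Unit) F
          (LieH1.H F (Special.S F p n) (Special.belowTau F p n))),
      (∀ i : Fin n, b (Sum.inl i) = LieH1.mkClass (Special.chi F p i) (hchi i)) ∧
        b (Sum.inr ()) = LieH1.mkClass (Special.adTau F p n) hadTau := by
  refine ⟨Special.chi_mem_Z, Special.adTau_mem_Z,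
    Module.Basis.mk (Submodule.linearIndependent_mkQ (Special.basicCocycle_coeff_eq_zero hn))
      (Submodule.span_range_mkQ (Special.exists_sub_basicCocycle_mem_B hp hn)), fun i => ?_, ?_⟩
  · rw [Module.Basis.mk_apply]; rfl
  · rw [Module.Basis.mk_apply]; rfl
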